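/- Let $R$ and $S$ be associative rings with $1$. Write $\mathrm{Mod}\text{-}R$, $\mathrm{Mod}\text{-}S$ and $R\text{-}\mathrm{Mod}\text{-}S$ for the categories of right $R$-modules, right $S$-modules and $(R,S)$-bimodules (the latter being modules over $R\otimes_{\mathbb Z}S^{\mathrm{op}}$). A *pp formula* $\phi(\bar x)$ is a formula $\exists\bar y\,(\bar xA+\bar yB=0)$ with $A,B$ finite matrices over the ring; $\phi(M)$ denotes its solution set in a module $M$, and the pp-type of a tuple $\bar a$ from $M$ is $\mathrm{pp}^M(\bar a)=\{\phi:\bar a\in\phi(M)\}$. A submodule $P\le N$ is *pure* if every pp formula satisfied in $N$ by a finite tuple from $P$ is satisfied by it in $P$. A full, isomorphism-closed subcategory of one of these module categories is *definable* if it is closed under direct products, directed colimits and pure submodules. A definable subcategory $\mathcal D$ is *$\varinjlim$-generated* by a class of modules if every member of $\mathcal D$ is a directed colimit of members of $\mathcal D$ that lie in that class. Let $\phi(\bar x)$ be the pp formula $\exists\bar y\,(\bar xA+\bar yB=0)$ for right $R$-modules, its variables $\bar x$ partitioned into $k$ blocks $\bar x_1,\dots,\bar x_k$, and let $\sigma(v_1,\dots,v_k)$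 be the pp formula $\exists\bar w\,\bigwedge_j\big(\sum_l v_ls_{lj}+\sum_i w_it_{ij}=0\big)$ for right $S$-modules. Then $(\sigma:\phi)$ is the pp formula for $(R,S)$-bimodules, with free variables $\bar z=(\bar z_1,\dots,\bar z_k)$ matching $\bar x$, which says that there are tuples $\bar u_i$ (one for each $w_i$), each of the length of $(\bar x,\bar y)$, such that for every $j$ there is a tuple $\bar z'_j$ with $$\big(\bar z_1s_{1j},\dots,\bar z_ks_{kj},\,\bar 0\big)+\sum_i\bar u_it_{ij}=\begin{pmatrix}A\\B\end{pmatrix}\bar z'_j$$ (tuples from the bimodule being regarded as columns). It expresses that tensoring with a tuple satisfying $\phi$ yields, blockwise, a tuple satisfying $\sigma$. A right $R$-module $M$ is *atomic with respect to* an $(R,S)$-bimodule $B$ if for every $k$, every finite tuple $\bar a$ from $M$ partitioned into $k$ blocks, and every pp formula $\sigma$ for right $S$-modules in $k$ free variables, there is $\phi\in\mathrm{pp}^M(\bar a)$ such that $(\sigma:\phi)(B)$ is maximal among the subgroups $(\sigma:\psi)(B)$ with $\psi\in\mathrm{pp}^M(\bar a)$. **Theorem.** Let $\mathcal D$ be a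 definable subcategory of $\mathrm{Mod}\text{-}R$ that is $\varinjlim$-generated by modules which are atomic with respect to all $(R,S)$-bimodules, and let $\mathcal E$ be a definable subcategory of $\mathrm{Mod}\text{-}S$. Then $$(\mathcal E:\mathcal D)=\{\,{}_RB_S : M\otimes_RB\in\mathcal E\ \text{for all}\ M\in\mathcal D\,\}$$ is a definable subcategory of $R\text{-}\mathrm{Mod}\text{-}S$. The hypothesis on $\mathcal D$ holds, for example, whenever $\mathcal D$ is $\varinjlim$-generated by the finitely presented modules in it. -/

import Mathlib

universe u

open scoped TensorProduct MulOpposite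

namespace DefSub

/-! ### Positive primitive formulas -/

/-- A pp formula in `n` free variables, in the language of left modules over the ring `T`: an
existentially quantified finite homogeneous system of `T`-linear equations. The bound variables and
the equations are indexed by finite types. Right `R`-modules are left modules over `Rᵐᵒᵖ`
(`MulOpposite.op r • m` is `m r`), so a `PPFormula Rᵐᵒᵖ n` is a pp formula for right `R`-modules. -/
structure PPFormula (T : Type u) (n : ℕ) where
  /-- the bound variables -/
  bound : Type
  /-- the equations -/
  eqs : Type
  [fintypeBound : Fintype bound]
  [fintypeEqs : Fintype eqs]
  /-- the coefficients of the free variables -/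
  A : eqs → Fin n → T
  /-- the coefficients of the bound variables -/
  B : eqs → bound → T

attribute [instance] PPFormula.fintypeBound PPFormula.fintypeEqs

/-- The solution set `φ(M)`: the tuples `a` in `M` such that `M ⊨ φ(a)`. -/
def PPFormula.sol {T : Type u} [Ring T] {n : ℕ} (φ : PPFormula T n)
    (M : Type u) [AddCommGroup M] [Module T M] : Set (Fin n → M) :=
  {a | ∃ b : φ.bound → M, ∀ j : φ.eqs, ∑ i, φ.A j i • a i + ∑ k, φ.B j k • b k = 0}

/-! ### Definable subcategories -/

/-- `P` is a pure submodule of `N`: every pp formula satisfied in `N` by a finite tuple from `P` is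
satisfied by that tuple in `P`. -/
def IsPure {T : Type u} [Ring T] {N : Type u} [AddCommGroup N] [Module T N]
    (P : Submodule T N) : Prop :=
  ∀ (n : ℕ) (φ : PPFormula T n) (a : Fin n → P), (fun i => (a i : N)) ∈ φ.sol N → a ∈ φ.sol P

/-- `M` is (isomorphic to) the colimit of a directed system of modules that all lie in `X`. -/
def IsDirectedColimitOf {T : Type u} [Ring T]
    (X : CategoryTheory.ObjectProperty (ModuleCat.{u} T)) (M : ModuleCat.{u} T) : Prop :=
  ∃ (ι : Type u) (_ : Preorder ι) (_ : IsDirectedOrder ι) (_ : Nonempty ι) (_ : DecidableEq ι)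
    (G : ι → ModuleCat.{u} T) (f : ∀ i j, i ≤ j → G i →ₗ[T] G j)
    (_ : DirectedSystem (fun i => G i) fun i j h => f i j h),
    (∀ i, X (G i)) ∧ Nonempty (Module.DirectLimit (fun i => G i) f ≃ₗ[T] M)

/-- A full subcategory (given by the property of belonging to it) of the category of `T`-modules is
definable if it is closed under isomorphism, direct products, directed colimits and pure
submodules. -/
structure IsDefinable {T : Type u} [Ring T]
    (X : CategoryTheory.ObjectProperty (ModuleCat.{u} T)) : Prop where
  iso : ∀ M N : ModuleCat.{u} T, Nonempty (M ≃ₗ[T] N) → X M → X N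
  pi : ∀ (ι : Type u) (M : ι → ModuleCat.{u} T), (∀ i, X (M i)) →
    X (ModuleCat.of T (∀ i, M i))
  directedColimit : ∀ M : ModuleCat.{u} T, IsDirectedColimitOf X M → X M
  pure : ∀ (N : ModuleCat.{u} T) (P : Submodule T N), IsPure P → X N → X (ModuleCat.of T P)

/-- `X` is generated, under directed colimits, by those of its members that satisfy `Y`: every
member of `X` is a directed colimit of members of `X` that satisfy `Y`. -/
def IsLimGeneratedBy {T : Type u} [Ring T]
    (X Y : CategoryTheory.ObjectProperty (ModuleCat.{u} T)) : Prop :=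
  ∀ M : ModuleCat.{u} T, X M → IsDirectedColimitOf (X ⊓ Y) M

/-! ### Right modules, bimodules and their tensor product -/

/-- The category `Mod-R` of right `R`-modules. -/
abbrev RightMod (R : Type u) [Ring R] : Type (u + 1) := ModuleCat.{u} Rᵐᵒᵖ

/-- The category `R-Mod-S` of `(R, S)`-bimodules, as modules over `R ⊗ Sᵐᵒᵖ`: on a bimodule `B`
one has `r b = (r ⊗ₜ 1) • b` and `b s = (1 ⊗ₜ MulOpposite.op s) • b`. -/
abbrev Bimod (R S : Type u) [Ring R] [Ring S] : Type (u + 1) := ModuleCat.{u} (R ⊗[ℤ] Sᵐᵒᵖ)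

section Tensor

variable (R S : Type u) [Ring R] [Ring S]
  (M : Type u) [AddCommGroup M] [Module Rᵐᵒᵖ M]
  (B : Type u) [AddCommGroup B] [Module (R ⊗[ℤ] Sᵐᵒᵖ) B]

/-- The subgroup of `M ⊗ B` (over the integers) generated by all `m r ⊗ b - m ⊗ r b`. -/
def balancing : AddSubgroup (M ⊗[ℤ] B) :=
  AddSubgroup.closure {x | ∃ (m : M) (r : R) (b : B),
    x = (MulOpposite.op r • m) ⊗ₜ[ℤ] b - m ⊗ₜ[ℤ] ((r ⊗ₜ[ℤ] (1 : Sᵐᵒᵖ)) • b)}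

/-- The tensor product over the (not necessarily commutative) ring `R` of the right `R`-module `M`
and the `(R, S)`-bimodule `B`. -/
def Tensor : Type u := (M ⊗[ℤ] B) ⧸ balancing R S M B

instance : AddCommGroup (Tensor R S M B) :=
  inferInstanceAs (AddCommGroup ((M ⊗[ℤ] B) ⧸ balancing R S M B))

/-- The quotient map onto the tensor product over `R`. -/
def mk : M ⊗[ℤ] B →+ Tensor R S M B := QuotientAddGroup.mk' (balancing R S M B)

variable {M B} in
/-- The class of the elementary tensor of `m` and `b`. -/
def tmul (m : M) (b : B) : Tensor R S M B := mk R S M B (m ⊗ₜ[ℤ] b)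

variable {M B} in
theorem tensor_hom_ext {P : Type*} [AddCommGroup P] {f g : Tensor R S M B →+ P}
    (h : ∀ m b, f (tmul R S m b) = g (tmul R S m b)) : f = g := by
  refine QuotientAddGroup.addMonoidHom_ext _ (AddMonoidHom.ext fun x => ?_)
  induction x with
  | zero => simp
  | tmul m b => exact h m b
  | add x y hx hy => rw [map_add, map_add, hx, hy]

/-- Right multiplication by an element of `S` on a bimodule, as an additive map. -/
def rightMul (s : Sᵐᵒᵖ) : B →ₗ[ℤ] B :=
  (DistribSMul.toAddMonoidHom B ((1 : R) ⊗ₜ[ℤ] s)).toIntLinearMap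

theorem rightMul_apply (s : Sᵐᵒᵖ) (b : B) :
    rightMul R S B s b = ((1 : R) ⊗ₜ[ℤ] s) • b := rfl

theorem balancing_le (s : Sᵐᵒᵖ) : balancing R S M B ≤
    (balancing R S M B).comap ((rightMul R S B s).lTensor M).toAddMonoidHom := by
  refine (AddSubgroup.closure_le _).2 ?_
  rintro _ ⟨m, r, b, rfl⟩
  refine AddSubgroup.subset_closure ⟨m, r, ((1 : R) ⊗ₜ[ℤ] s) • b, ?_⟩
  simp [rightMul_apply, smul_smul]

/-- The endomorphism of the tensor product induced by right multiplication by `s` on `B`. -/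
def actionMap (s : Sᵐᵒᵖ) : Tensor R S M B →+ Tensor R S M B :=
  QuotientAddGroup.map (balancing R S M B) (balancing R S M B)
    ((rightMul R S B s).lTensor M).toAddMonoidHom (balancing_le R S M B s)

variable {M B} in
theorem actionMap_tmul (s : Sᵐᵒᵖ) (m : M) (b : B) :
    actionMap R S M B s (tmul R S m b) = tmul R S m (((1 : R) ⊗ₜ[ℤ] s) • b) := rfl

/-- The right action of `S` on the tensor product, coming from its action on `B`. -/
def action : Sᵐᵒᵖ →+* AddMonoid.End (Tensor R S M B) where
  toFun s := actionMap R S M B s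
  map_one' := tensor_hom_ext R S fun m b => by
    have h : ((1 : R) ⊗ₜ[ℤ] (1 : Sᵐᵒᵖ)) • b = b := one_smul (R ⊗[ℤ] Sᵐᵒᵖ) b
    rw [actionMap_tmul, h]
    rfl
  map_mul' s t := tensor_hom_ext R S fun m b => by
    have h : ((1 : R) ⊗ₜ[ℤ] (s * t)) • b
        = ((1 : R) ⊗ₜ[ℤ] s) • ((1 : R) ⊗ₜ[ℤ] t) • b := by
      rw [smul_smul, Algebra.TensorProduct.tmul_mul_tmul, one_mul]
    rw [actionMap_tmul, h]
    rfl
  map_zero' := tensor_hom_ext R S fun m b => by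
    have h : ((1 : R) ⊗ₜ[ℤ] (0 : Sᵐᵒᵖ)) • b = 0 := by
      rw [TensorProduct.tmul_zero]
      exact zero_smul (R ⊗[ℤ] Sᵐᵒᵖ) b
    rw [actionMap_tmul, h, tmul, TensorProduct.tmul_zero, map_zero]
    rfl
  map_add' s t := tensor_hom_ext R S fun m b => by
    have h : ((1 : R) ⊗ₜ[ℤ] (s + t)) • b
        = ((1 : R) ⊗ₜ[ℤ] s) • b + ((1 : R) ⊗ₜ[ℤ] t) • b := by
      rw [TensorProduct.tmul_add]
      exact add_smul _ _ b
    rw [actionMap_tmul, h, tmul, TensorProduct.tmul_add, map_add]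
    rfl

instance : Module Sᵐᵒᵖ (Tensor R S M B) := Module.compHom _ (action R S M B)

variable {M B} in
theorem smul_tmul (s : Sᵐᵒᵖ) (m : M) (b : B) :
    s • tmul R S m b = tmul R S m (((1 : R) ⊗ₜ[ℤ] s) • b) := rfl

variable {M B} in
theorem tmul_balanced (m : M) (r : R) (b : B) :
    tmul R S (MulOpposite.op r • m) b = tmul R S m ((r ⊗ₜ[ℤ] (1 : Sᵐᵒᵖ)) • b) :=
  (QuotientAddGroup.eq_iff_sub_mem).2 (AddSubgroup.subset_closure ⟨m, r, b, rfl⟩)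

end Tensor

/-- The right `S`-module obtained by tensoring a right `R`-module with an `(R, S)`-bimodule. -/
abbrev tensorObj {R S : Type u} [Ring R] [Ring S] (M : RightMod R) (B : Bimod R S) : RightMod S :=
  ModuleCat.of Sᵐᵒᵖ (Tensor R S M B)

/-- The class `(E : D)` of all `(R, S)`-bimodules `B` such that tensoring with `B` takes every
member of `D` to a member of `E`. -/
def transporter {R S : Type u} [Ring R] [Ring S]
    (E : CategoryTheory.ObjectProperty (RightMod S))
    (D : CategoryTheory.ObjectProperty (RightMod R)) :
    CategoryTheory.ObjectProperty (Bimod R S) :=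
  fun B => ∀ M : RightMod R, D M → E (tensorObj M B)

/-! ### The formula `(σ : φ)` and atomicity with respect to a bimodule -/

open scoped Classical in
/-- The pp formula `(σ : φ)` for `(R, S)`-bimodules. Here `σ` is a pp formula for right
`S`-modules in `k` free variables, `φ` is a pp formula for right `R`-modules in `n` free variables,
and `p` sorts the free variables of `φ` into `k` blocks, one for each free variable of `σ`.

If `φ(x)` is `∃ y, x A + y B = 0` and `σ(v)` is `∃ w, v C + w F = 0`, write `θ(x, y)` for the
quantifier-free formula `x A + y B = 0`. With generators `x, y` and relations `θ`, one has the
finitely presented module `C_φ` in which `x` freely realises `φ`. Then `(σ : φ)(z)` says that there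
are tuples `u_i` (one for each variable in `w`, each of the length of `(x, y)`) such that, for
each equation `j` of `σ`, the tuple `t_j := (∑_l z_l C_{l j}, 0) + ∑_i u_i F_{i j}` satisfies the
dual formula `Dθ`, that is, `t_j = (A z'_j, B z'_j)` for some tuple `z'_j`. In coordinates:
* for a free variable `x` of `φ`, `z_x C_{p(x) j} + ∑_i u_{i x} F_{i j} = ∑_q A_{x q} z'_{j q}`,
* for a bound variable `y` of `φ`, `∑_i u_{i y} F_{i j} = ∑_q B_{y q} z'_{j q}`. -/
noncomputable def colonFormula {R S : Type u} [Ring R] [Ring S] {n k : ℕ} (p : Fin n → Fin k)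
    (σ : PPFormula Sᵐᵒᵖ k) (φ : PPFormula Rᵐᵒᵖ n) : PPFormula (R ⊗[ℤ] Sᵐᵒᵖ) n where
  bound := (σ.bound × (Fin n ⊕ φ.bound)) ⊕ (σ.eqs × φ.eqs)
  eqs := σ.eqs × (Fin n ⊕ φ.bound)
  fintypeBound := inferInstance
  fintypeEqs := inferInstance
  A := fun e i =>
    match e with
    | (j, .inl x) => if i = x then (1 : R) ⊗ₜ[ℤ] σ.A j (p x) else 0
    | (_, .inr _) => 0
  B := fun e v =>
    match v with
    | .inl (i, g) => if g = e.2 then (1 : R) ⊗ₜ[ℤ] σ.B e.1 i else 0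
    | .inr (j, q) =>
      if j = e.1 then
        match e.2 with
        | .inl x => -((φ.A q x).unop ⊗ₜ[ℤ] (1 : Sᵐᵒᵖ))
        | .inr y => -((φ.B q y).unop ⊗ₜ[ℤ] (1 : Sᵐᵒᵖ))
      else 0

/-- The right `R`-module `M` is atomic with respect to the `(R, S)`-bimodule `B`: for every finite
tuple `a` from `M`, partitioned into `k` blocks, and every pp formula `σ` for right `S`-modules in
`k` free variables, there is `φ` in the pp-type of `a` in `M` such that `(σ : φ)(B)` is maximal among
the subgroups `(σ : ψ)(B)` with `ψ` in the pp-type of `a` in `M`. -/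
def IsAtomicWrt {R S : Type u} [Ring R] [Ring S] (M : RightMod R) (B : Bimod R S) : Prop :=
  ∀ (n k : ℕ) (p : Fin n → Fin k), Function.Surjective p →
    ∀ (a : Fin n → M) (σ : PPFormula Sᵐᵒᵖ k),
      ∃ φ : PPFormula Rᵐᵒᵖ n,
        MaximalFor (fun ψ : PPFormula Rᵐᵒᵖ n => a ∈ ψ.sol M)
          (fun ψ => (colonFormula p σ ψ).sol B) φ

/-- The right `R`-modules that are atomic with respect to all `(R, S)`-bimodules. -/
def atomicModules (R S : Type u) [Ring R] [Ring S] : CategoryTheory.ObjectProperty (RightMod R) :=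
  fun M => ∀ B : Bimod R S, IsAtomicWrt M B

/-- The finitely presented right `R`-modules. -/
def fpModules (R : Type u) [Ring R] : CategoryTheory.ObjectProperty (RightMod R) :=
  fun M => Module.FinitePresentation Rᵐᵒᵖ M

end DefSub

/-! Everything rests on a criterion for pp formulas in a tensor product: the blockwise sums of `a ⊗
b` satisfy `σ` in `M ⊗ B` exactly when some `φ` in the pp-type of `a` has `b ∈ (σ : φ)(B)`. One
direction, `blockSum_mem_sol`, is substitution. For the other, `exists_mem_sol_of_blockSum_mem_sol`,
take generators and relations for `M`: a solution of `σ` in the tensor product lifts to finitely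
supported families in `B`, and each equation then holds modulo the relations. Only finitely many
relations and generators are involved, and they form `φ`.

Since `b` enters only through pp formulas over bimodules, pure embeddings `B → B'` stay pure after
tensoring with `M` (`IsPureMap.tensorMap`), which gives closure under pure submodules and
isomorphisms. Directed colimits are preserved by tensoring.

Products are where atomicity enters. If the tuple satisfies `σ` in each `N ⊗ B i`, the criterion
yields a formula depending on `i`. For `N` atomic with respect to the product bimodule, conjunctions
turn the maximal subgroup into a greatest one, so a single `φ` serves all `i`. Hence `N ⊗ ∏ B i → ∏
(N ⊗ B i)` is pure (`IsAtomicWrt.isPureMap_tensorPi`). A general member of `D` is a directed colimit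
of such `N`. For finitely presented modules, one finite presentation provides a `φ` that works for
every bimodule. -/

namespace DefSub

/-! ### Pp formulas, pure maps and directed colimits. -/

section PP

variable {T : Type u} [Ring T]

theorem PPFormula.sol_map {M N : Type u} [AddCommGroup M] [Module T M] [AddCommGroup N]
    [Module T N] (f : M →ₗ[T] N) {n : ℕ} {φ : PPFormula T n} {a : Fin n → M}
    (h : a ∈ φ.sol M) : (fun i => f (a i)) ∈ φ.sol N := by
  obtain ⟨b, hb⟩ := h
  refine ⟨fun k => f (b k), fun j => ?_⟩
  rw [← map_zero f, ← hb j]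
  simp

theorem PPFormula.mem_sol_pi {ι : Type u} {M : ι → Type u} [∀ i, AddCommGroup (M i)]
    [∀ i, Module T (M i)] {n : ℕ} {φ : PPFormula T n} {a : Fin n → ∀ i, M i} :
    a ∈ φ.sol (∀ i, M i) ↔ ∀ i, (fun x => a x i) ∈ φ.sol (M i) := by
  refine ⟨fun h i => PPFormula.sol_map (LinearMap.proj i) h, fun h => ?_⟩
  choose b hb using h
  refine ⟨fun k i => b i k, fun j => funext fun i => ?_⟩
  simpa using hb i j

/-- The formula `x = 0`. -/
def PPFormula.isZero (T : Type u) [Ring T] : PPFormula T 1 where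
  bound := Empty
  eqs := Unit
  A := 1
  B := 0

theorem PPFormula.mem_sol_isZero {M : Type u} [AddCommGroup M] [Module T M] {a : Fin 1 → M} :
    a ∈ (PPFormula.isZero T).sol M ↔ a 0 = 0 := by
  simp [PPFormula.isZero, PPFormula.sol]

/-- The conjunction of two pp formulas. -/
def PPFormula.conj {n : ℕ} (φ ψ : PPFormula T n) : PPFormula T n where
  bound := φ.bound ⊕ ψ.bound
  eqs := φ.eqs ⊕ ψ.eqs
  A := Sum.elim φ.A ψ.A
  B := Sum.elim (fun j => Sum.elim (φ.B j) 0) (fun j => Sum.elim 0 (ψ.B j))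

theorem PPFormula.mem_sol_conj {n : ℕ} {φ ψ : PPFormula T n} {M : Type u} [AddCommGroup M]
    [Module T M] {a : Fin n → M} (hφ : a ∈ φ.sol M) (hψ : a ∈ ψ.sol M) :
    a ∈ (φ.conj ψ).sol M := by
  obtain ⟨b, hb⟩ := hφ
  obtain ⟨c, hc⟩ := hψ
  refine ⟨(Sum.elim b c : φ.bound ⊕ ψ.bound → M), ?_⟩
  rintro (j | j)
  · refine Eq.trans ?_ (hb j)
    congr 1
    refine (Fintype.sum_sum_type _).trans ?_
    simp [PPFormula.conj]
  · refine Eq.trans ?_ (hc j)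
    congr 1
    refine (Fintype.sum_sum_type _).trans ?_
    simp [PPFormula.conj]

/-- A map is pure if it reflects the satisfaction of pp formulas. -/
def IsPureMap {M N : Type u} [AddCommGroup M] [Module T M] [AddCommGroup N] [Module T N]
    (f : M →ₗ[T] N) : Prop :=
  ∀ (n : ℕ) (φ : PPFormula T n) (a : Fin n → M), (fun i => f (a i)) ∈ φ.sol N → a ∈ φ.sol M

theorem IsPureMap.injective {M N : Type u} [AddCommGroup M] [Module T M] [AddCommGroup N]
    [Module T N] {f : M →ₗ[T] N} (hf : IsPureMap f) : Function.Injective f := by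
  refine (injective_iff_map_eq_zero f).2 fun m hm => ?_
  exact PPFormula.mem_sol_isZero.1
    (hf 1 (PPFormula.isZero T) (fun _ => m) (PPFormula.mem_sol_isZero.2 hm))

/-- A pure map is injective, so its domain is isomorphic to its range, which is a pure submodule.
All closure properties below except that under directed colimits conclude through this. -/
theorem IsDefinable.of_isPureMap {X : CategoryTheory.ObjectProperty (ModuleCat.{u} T)}
    (hX : IsDefinable X) {M N : ModuleCat.{u} T} (f : M →ₗ[T] N) (hf : IsPureMap f) (hN : X N) :
    X M := by
  refine hX.iso (ModuleCat.of T (LinearMap.range f)) M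
    ⟨(LinearEquiv.ofInjective f hf.injective).symm⟩ (hX.pure N _ ?_ hN)
  intro n φ a ha
  choose c hc using fun i => (a i).2
  have h : (fun i => f (c i)) ∈ φ.sol N := by simpa only [hc] using ha
  have h' := PPFormula.sol_map f.rangeRestrict (hf n φ c h)
  convert h' using 2 with i
  exact Subtype.ext (hc i).symm

section DirectedColimit

variable {ι : Type u} [Preorder ι] {G : ι → Type u} [∀ i, AddCommGroup (G i)]
  [∀ i, Module T (G i)] {f : ∀ i j, i ≤ j → G i →ₗ[T] G j}
  {M : Type u} [AddCommGroup M] [Module T M]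

/-- An elementwise description of the colimit cocones of a directed system of modules. -/
structure IsDirectedColimitCocone (f : ∀ i j, i ≤ j → G i →ₗ[T] G j) (c : ∀ i, G i →ₗ[T] M) :
    Prop where
  compat : ∀ i j (h : i ≤ j) (x : G i), c j (f i j h x) = c i x
  exists_of : ∀ m : M, ∃ (i : ι) (x : G i), c i x = m
  zero_exact : ∀ (i : ι) (x : G i), c i x = 0 → ∃ (j : ι) (h : i ≤ j), f i j h x = 0

theorem isDirectedColimitCocone_const [Nonempty ι] :
    IsDirectedColimitCocone (fun (i j : ι) (_ : i ≤ j) => (LinearMap.id : M →ₗ[T] M))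
      fun _ => LinearMap.id where
  compat _ _ _ _ := rfl
  exists_of m := ⟨Classical.arbitrary ι, m, rfl⟩
  zero_exact i _ h := ⟨i, le_rfl, h⟩

theorem isDirectedColimitCocone_of_linearEquiv [IsDirectedOrder ι] [Nonempty ι] [DecidableEq ι]
    [DirectedSystem G fun i j h => f i j h] (e : Module.DirectLimit G f ≃ₗ[T] M) :
    IsDirectedColimitCocone f fun i => e.toLinearMap ∘ₗ Module.DirectLimit.of T ι G f i where
  compat i j h x := by simp [Module.DirectLimit.of_f]
  exists_of m := by
    obtain ⟨i, x, hx⟩ := Module.DirectLimit.exists_of (e.symm m)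
    exact ⟨i, x, by simp [hx]⟩
  zero_exact i x h := Module.DirectLimit.of.zero_exact (by simpa using h)

namespace IsDirectedColimitCocone

variable {c : ∀ i, G i →ₗ[T] M}

theorem bijective_lift (hc : IsDirectedColimitCocone f c) [IsDirectedOrder ι] [Nonempty ι] [DecidableEq ι] :
    Function.Bijective (Module.DirectLimit.lift T ι G f c hc.compat) := by
  constructor
  · refine (injective_iff_map_eq_zero _).2 fun x hx => ?_
    obtain ⟨i, x, rfl⟩ := Module.DirectLimit.exists_of x
    rw [Module.DirectLimit.lift_of] at hx
    obtain ⟨j, hij, h⟩ := hc.zero_exact i x hx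
    rw [← Module.DirectLimit.of_f (hij := hij), h, map_zero]
  · intro m
    obtain ⟨i, x, rfl⟩ := hc.exists_of m
    exact ⟨_, Module.DirectLimit.lift_of _ _ _⟩

theorem exists_stage_of_finite (hc : IsDirectedColimitCocone f c) [IsDirectedOrder ι]
    [Nonempty ι] {κ : Type*} [Finite κ] (x : κ → M) (i : ι) : ∃ j, i ≤ j ∧ ∃ y : κ → G j, ∀ k, c j (y k) = x k := by
  choose s y hy using fun k => hc.exists_of (x k)
  -- The index `none` carries `i`, so that `j` bounds `i` together with all the stages `s k`.
  obtain ⟨j, hj⟩ := Finite.exists_le (fun k : Option κ => k.elim i s)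
  have hs : ∀ k, s k ≤ j := fun k => hj (some k)
  refine ⟨j, hj none, fun k => f (s k) j (hs k) (y k), fun k => ?_⟩
  rw [hc.compat, hy]

theorem exists_stage_eq_zero (hc : IsDirectedColimitCocone f c) [IsDirectedOrder ι] [Nonempty ι]
    [DirectedSystem G fun i j h => f i j h] {κ : Type*} [Finite κ] {i : ι} (x : κ → G i)
    (h : ∀ k, c i (x k) = 0) : ∃ (j : ι) (hij : i ≤ j), ∀ k, f i j hij (x k) = 0 := by
  choose s hs hx using fun k => hc.zero_exact i (x k) (h k)
  obtain ⟨j, hj⟩ := Finite.exists_le (fun k : Option κ => k.elim i s)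
  refine ⟨j, hj none, fun k => ?_⟩
  rw [← DirectedSystem.map_map' f (hs k) (hj (some k)), hx, map_zero]

/-- A pp formula that holds in a directed colimit holds at some stage. -/
theorem exists_stage_mem_sol (hc : IsDirectedColimitCocone f c) [IsDirectedOrder ι] [Nonempty ι]
    [DirectedSystem G fun i j h => f i j h] {n : ℕ} {φ : PPFormula T n} {i : ι} {a : Fin n → G i}
    (h : (fun x => c i (a x)) ∈ φ.sol M) :
    ∃ (j : ι) (hij : i ≤ j), (fun x => f i j hij (a x)) ∈ φ.sol (G j) := by
  obtain ⟨b, hb⟩ := h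
  obtain ⟨j, hij, d, hd⟩ := hc.exists_stage_of_finite b i
  obtain ⟨k, hjk, hk⟩ := hc.exists_stage_eq_zero
    (fun e => ∑ x, φ.A e x • f i j hij (a x) + ∑ y, φ.B e y • d y) fun e => by
      simpa [hc.compat, hd] using hb e
  refine ⟨k, hij.trans hjk, fun y => f j k hjk (d y), fun e => ?_⟩
  simpa [DirectedSystem.map_map' f] using hk e

end IsDirectedColimitCocone

end DirectedColimit

end PP

/-! ### Universal property and functoriality of the tensor product. -/

section Tensor

variable {R S : Type u} [Ring R] [Ring S]
  {M M' : Type u} [AddCommGroup M] [Module Rᵐᵒᵖ M] [AddCommGroup M'] [Module Rᵐᵒᵖ M']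
  {B B' : Type u} [AddCommGroup B] [Module (R ⊗[ℤ] Sᵐᵒᵖ) B]
  [AddCommGroup B'] [Module (R ⊗[ℤ] Sᵐᵒᵖ) B']

variable (R S M B) in
/-- The elementary tensor as a biadditive map. -/
def tmulHom : M →+ B →+ Tensor R S M B :=
  AddMonoidHom.mk' (fun m => AddMonoidHom.mk' (fun b => tmul R S m b) fun b b' => by
      simp [tmul, TensorProduct.tmul_add]) fun m m' => by
    ext b
    simp [tmul, TensorProduct.add_tmul]

theorem tmulHom_apply (m : M) (b : B) : tmulHom R S M B m b = tmul R S m b := rfl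

theorem tmul_sum {ι : Type*} (s : Finset ι) (m : M) (b : ι → B) :
    tmul R S m (∑ i ∈ s, b i) = ∑ i ∈ s, tmul R S m (b i) :=
  map_sum (tmulHom R S M B m) b s

theorem sum_tmul {ι : Type*} (s : Finset ι) (m : ι → M) (b : B) :
    tmul R S (∑ i ∈ s, m i) b = ∑ i ∈ s, tmul R S (m i) b :=
  map_sum ((tmulHom R S M B).flip b) m s

theorem tmul_add (m : M) (b b' : B) : tmul R S m (b + b') = tmul R S m b + tmul R S m b' :=
  map_add (tmulHom R S M B m) b b'

theorem add_tmul (m m' : M) (b : B) : tmul R S (m + m') b = tmul R S m b + tmul R S m' b :=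
  map_add ((tmulHom R S M B).flip b) m m'

@[simp] theorem tmul_zero (m : M) : tmul R S m (0 : B) = 0 := map_zero (tmulHom R S M B m)

@[simp] theorem zero_tmul (b : B) : tmul R S (0 : M) b = 0 :=
  map_zero ((tmulHom R S M B).flip b)

/-- The additive map out of the tensor product defined by a balanced biadditive map. -/
def Tensor.lift {P : Type*} [AddCommGroup P] (h : M →+ B →+ P)
    (hh : ∀ (m : M) (r : R) (b : B),
      h (MulOpposite.op r • m) b = h m ((r ⊗ₜ[ℤ] (1 : Sᵐᵒᵖ)) • b)) :
    Tensor R S M B →+ P :=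
  QuotientAddGroup.lift (balancing R S M B)
    (TensorProduct.liftAddHom (R := ℤ) h fun r m b => by simp) <| by
      refine (AddSubgroup.closure_le _).2 ?_
      rintro _ ⟨m, r, b, rfl⟩
      simp [hh, AddMonoidHom.mem_ker]

theorem Tensor.lift_tmul {P : Type*} [AddCommGroup P] (h : M →+ B →+ P)
    (hh : ∀ (m : M) (r : R) (b : B),
      h (MulOpposite.op r • m) b = h m ((r ⊗ₜ[ℤ] (1 : Sᵐᵒᵖ)) • b)) (m : M) (b : B) :
    Tensor.lift h hh (tmul R S m b) = h m b := rfl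

@[elab_as_elim]
theorem Tensor.induction {P : Tensor R S M B → Prop} (zero : P 0)
    (tmul : ∀ m b, P (tmul R S m b)) (add : ∀ x y, P x → P y → P (x + y))
    (x : Tensor R S M B) : P x := by
  obtain ⟨t, rfl⟩ := QuotientAddGroup.mk'_surjective (balancing R S M B) x
  induction t with
  | zero => exact zero
  | tmul m b => exact tmul m b
  | add x y hx hy =>
    rw [map_add]
    exact add _ _ hx hy

/-- The map between tensor products induced by linear maps of both factors. -/
def Tensor.map (f : M →ₗ[Rᵐᵒᵖ] M') (g : B →ₗ[R ⊗[ℤ] Sᵐᵒᵖ] B') :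
    Tensor R S M B →ₗ[Sᵐᵒᵖ] Tensor R S M' B' where
  __ := Tensor.lift
    (((tmulHom R S M' B').comp f.toAddMonoidHom).compl₂ g.toAddMonoidHom) fun m r b => by
      simp [tmulHom_apply, tmul_balanced]
  map_smul' s x := by
    induction x using Tensor.induction with
    | zero => simp
    | tmul m b =>
      rw [smul_tmul]
      change tmul R S (f m) (g _) = s • tmul R S (f m) (g b)
      rw [smul_tmul, map_smul]
    | add x y hx hy =>
      rw [smul_add]
      simp_all

@[simp]
theorem Tensor.map_tmul (f : M →ₗ[Rᵐᵒᵖ] M') (g : B →ₗ[R ⊗[ℤ] Sᵐᵒᵖ] B') (m : M) (b : B) :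
    Tensor.map f g (tmul R S m b) = tmul R S (f m) (g b) := rfl

theorem Tensor.linearMap_ext {P : Type*} [AddCommGroup P] [Module Sᵐᵒᵖ P]
    {f g : Tensor R S M B →ₗ[Sᵐᵒᵖ] P} (h : ∀ m b, f (tmul R S m b) = g (tmul R S m b)) :
    f = g :=
  LinearMap.toAddMonoidHom_injective (tensor_hom_ext R S h)

end Tensor

/-! ### The formula `(σ : φ)` and tuples in the tensor product. -/

section Colon

variable {R S : Type u} [Ring R] [Ring S]
  {M : Type u} [AddCommGroup M] [Module Rᵐᵒᵖ M]
  {B : Type u} [AddCommGroup B] [Module (R ⊗[ℤ] Sᵐᵒᵖ) B]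

theorem left_smul_smul (r r' : R) (b : B) :
    (r ⊗ₜ[ℤ] (1 : Sᵐᵒᵖ)) • (r' ⊗ₜ[ℤ] (1 : Sᵐᵒᵖ)) • b = ((r * r') ⊗ₜ[ℤ] (1 : Sᵐᵒᵖ)) • b := by
  simp [smul_smul]

theorem zero_tensor_smul (b : B) : (0 : R ⊗[ℤ] Sᵐᵒᵖ) • b = 0 :=
  zero_smul (R ⊗[ℤ] Sᵐᵒᵖ) b

variable (R S B) in
/-- The left multiplication by elements of `R` on a bimodule, as a biadditive map. -/
def leftMul : Rᵐᵒᵖ →+ B →+ B :=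
  AddMonoidHom.mk' (fun r => AddMonoidHom.mk' (fun b => (r.unop ⊗ₜ[ℤ] (1 : Sᵐᵒᵖ)) • b) fun b b' =>
    smul_add _ b b') fun r r' => by
      ext b
      simp [TensorProduct.add_tmul, add_smul]

theorem leftMul_apply (r : Rᵐᵒᵖ) (b : B) :
    leftMul R S B r b = (r.unop ⊗ₜ[ℤ] (1 : Sᵐᵒᵖ)) • b := rfl

theorem leftMul_mul (r r' : Rᵐᵒᵖ) (b : B) :
    leftMul R S B (r * r') b = leftMul R S B r' (leftMul R S B r b) := by
  simp [leftMul_apply, left_smul_smul]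

theorem tmul_leftMul (m : M) (r : Rᵐᵒᵖ) (b : B) :
    tmul R S m (leftMul R S B r b) = tmul R S (r • m) b :=
  (tmul_balanced R S m r.unop b).symm

/-- Treating free and bound variables of `φ` as one index set merges the two kinds of coordinate
equations; the negated coefficients of `z'` are moved to the right-hand side. -/
theorem PPFormula.mem_sol_colonFormula {n k : ℕ} {p : Fin n → Fin k} {σ : PPFormula Sᵐᵒᵖ k}
    {φ : PPFormula Rᵐᵒᵖ n} {b : Fin n → B} :
    b ∈ (colonFormula p σ φ).sol B ↔
      ∃ (u : σ.bound → (Fin n ⊕ φ.bound) → B) (z : σ.eqs → φ.eqs → B), ∀ j x,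
        Sum.elim (fun x => ((1 : R) ⊗ₜ[ℤ] σ.A j (p x)) • b x) 0 x
          + ∑ i, ((1 : R) ⊗ₜ[ℤ] σ.B j i) • u i x
          = ∑ q, leftMul R S B (Sum.elim (φ.A q) (φ.B q) x) (z j q) := by
  classical
  have key : ∀ (c : (σ.bound × (Fin n ⊕ φ.bound)) ⊕ (σ.eqs × φ.eqs) → B)
      (j : σ.eqs) (x : Fin n ⊕ φ.bound),
      ∑ i, (colonFormula p σ φ).A (j, x) i • b i + ∑ v, (colonFormula p σ φ).B (j, x) v • c v
        = Sum.elim (fun x => ((1 : R) ⊗ₜ[ℤ] σ.A j (p x)) • b x) 0 x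
          + ∑ i, ((1 : R) ⊗ₜ[ℤ] σ.B j i) • c (.inl (i, x))
          - ∑ q, leftMul R S B (Sum.elim (φ.A q) (φ.B q) x) (c (.inr (j, q))) := by
    intro c j x
    rw [add_sub_assoc]
    congr 1
    · rcases x with x | x <;> simp [colonFormula, ite_smul, zero_tensor_smul]
    · refine (Fintype.sum_sum_type _).trans ?_
      rw [sub_eq_add_neg, Fintype.sum_prod_type, Fintype.sum_prod_type]
      congr 1
      · refine Finset.sum_congr rfl fun i _ => ?_
        rw [Finset.sum_eq_single x] <;> simp +contextual [colonFormula, zero_tensor_smul]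
      · rw [Finset.sum_comm]
        rcases x with x | x <;> simp [colonFormula, ite_smul, zero_tensor_smul, leftMul_apply]
  constructor
  · rintro ⟨c, hc⟩
    exact ⟨fun i x => c (.inl (i, x)), fun j q => c (.inr (j, q)), fun j x =>
      sub_eq_zero.1 ((key c j x).symm.trans (hc (j, x)))⟩
  · rintro ⟨u, z, h⟩
    exact ⟨Sum.elim (fun v => u v.1 v.2) (fun v => z v.1 v.2), fun e =>
      (key _ e.1 e.2).trans (sub_eq_zero.2 (h e.1 e.2))⟩

/-- Strengthening `φ` enlarges `(σ : φ)`: old witnesses survive once padded by zero at the new bound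
variables and the new equations. Thus the subgroups indexed by a pp-type form a directed family. -/
theorem PPFormula.sol_colonFormula_conj {n k : ℕ} {p : Fin n → Fin k} {σ : PPFormula Sᵐᵒᵖ k}
    (φ ψ : PPFormula Rᵐᵒᵖ n) :
    (colonFormula p σ φ).sol B ∪ (colonFormula p σ ψ).sol B ⊆
      (colonFormula p σ (φ.conj ψ)).sol B := by
  rintro b (hb | hb) <;> rw [mem_sol_colonFormula] at hb ⊢ <;> obtain ⟨u, z, h⟩ := hb
  · refine ⟨fun i => Sum.elim (u i ∘ Sum.inl) (Sum.elim (u i ∘ Sum.inr) 0),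
      fun j => Sum.elim (z j) 0, fun j x => ?_⟩
    have e := Fintype.sum_sum_type (fun q : φ.eqs ⊕ ψ.eqs =>
      leftMul R S B (Sum.elim ((φ.conj ψ).A q) ((φ.conj ψ).B q) x)
        (Sum.elim (z j) (0 : ψ.eqs → B) q))
    refine Eq.trans ?_ e.symm
    rcases x with x | x | x
    · exact (h j (.inl x)).trans (by simp [conj])
    · exact (h j (.inr x)).trans (by simp [conj])
    -- At a bound variable of `ψ` the padded witnesses vanish, so both sides are zero.
    · refine Eq.trans (b := (0 : B) + ∑ i, ((1 : R) ⊗ₜ[ℤ] σ.B j i) • (0 : B)) rfl ?_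
      simp [conj]
  · refine ⟨fun i => Sum.elim (u i ∘ Sum.inl) (Sum.elim 0 (u i ∘ Sum.inr)),
      fun j => Sum.elim 0 (z j), fun j x => ?_⟩
    have e := Fintype.sum_sum_type (fun q : φ.eqs ⊕ ψ.eqs =>
      leftMul R S B (Sum.elim ((φ.conj ψ).A q) ((φ.conj ψ).B q) x)
        (Sum.elim (0 : φ.eqs → B) (z j) q))
    refine Eq.trans ?_ e.symm
    rcases x with x | x | x
    · exact (h j (.inl x)).trans (by simp [conj])
    · refine Eq.trans (b := (0 : B) + ∑ i, ((1 : R) ⊗ₜ[ℤ] σ.B j i) • (0 : B)) rfl ?_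
      simp [conj]
    · exact (h j (.inr x)).trans (by simp [conj])

/-- The tuple in the tensor product whose `l`-th entry is the sum of the `a x ⊗ b x` over the
`l`-th block. -/
def blockSum {n k : ℕ} (p : Fin n → Fin k) (a : Fin n → M) (b : Fin n → B) :
    Fin k → Tensor R S M B :=
  fun l => ∑ x, if p x = l then tmul R S (a x) (b x) else 0

theorem sum_smul_blockSum {n k : ℕ} (p : Fin n → Fin k) (a : Fin n → M) (b : Fin n → B)
    (c : Fin k → Sᵐᵒᵖ) :
    ∑ l, c l • blockSum p a b l
      = ∑ x, tmul R S (a x) (((1 : R) ⊗ₜ[ℤ] c (p x)) • b x) := by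
  simp only [blockSum, Finset.smul_sum]
  rw [Finset.sum_comm]
  refine Finset.sum_congr rfl fun x _ => ?_
  rw [Finset.sum_eq_single (p x)] <;> simp +contextual [smul_tmul, eq_comm]

/-- Write each entry as a finite sum of elementary tensors and concatenate. Surjectivity of `p` is
needed because atomicity concerns only partitions into nonempty blocks. -/
theorem exists_eq_blockSum {k : ℕ} (v : Fin k → Tensor R S M B) :
    ∃ (n : ℕ) (p : Fin n → Fin k) (_ : Function.Surjective p) (a : Fin n → M) (b : Fin n → B),
      v = blockSum p a b := by
  have h : ∀ x : Tensor R S M B, ∃ (n : ℕ) (a : Fin n → M) (b : Fin n → B),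
      x = ∑ i, tmul R S (a i) (b i) := by
    intro x
    induction x using Tensor.induction with
    | zero => exact ⟨0, 0, 0, by simp⟩
    | tmul m b => exact ⟨1, fun _ => m, fun _ => b, by simp⟩
    | add x y hx hy =>
      obtain ⟨n, a, b, rfl⟩ := hx
      obtain ⟨n', a', b', rfl⟩ := hy
      exact ⟨n + n', Fin.append a a', Fin.append b b', by simp [Fin.sum_univ_add]⟩
  choose n a b hv using fun l => h (v l)
  -- The extra `none` in each block carries the tensor `0 ⊗ 0`, so that no block is empty even when
  -- its entry is an empty sum.
  let e := Fintype.equivFin (Σ l : Fin k, Option (Fin (n l)))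
  refine ⟨_, fun x => (e.symm x).1, fun l => ⟨e ⟨l, none⟩, by simp⟩,
    fun x => (e.symm x).2.elim 0 (a _), fun x => (e.symm x).2.elim 0 (b _), funext fun l => ?_⟩
  rw [blockSum, e.symm.sum_comp fun y : (Σ l : Fin k, Option (Fin (n l))) =>
    if y.1 = l then tmul R S (y.2.elim 0 (a y.1)) (y.2.elim 0 (b y.1)) else 0,
    Fintype.sum_sigma, Finset.sum_eq_single l]
  · simp [hv l]
  · intro l' _ h
    simp [h]
  · simp

/-- If `a` satisfies `φ` and `b` satisfies `(σ : φ)`, then `a ⊗ b` satisfies `σ` blockwise. -/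
theorem blockSum_mem_sol {n k : ℕ} {p : Fin n → Fin k} {σ : PPFormula Sᵐᵒᵖ k}
    {φ : PPFormula Rᵐᵒᵖ n} {a : Fin n → M} {b : Fin n → B} (ha : a ∈ φ.sol M)
    (hb : b ∈ (colonFormula p σ φ).sol B) :
    blockSum p a b ∈ σ.sol (Tensor R S M B) := by
  obtain ⟨c, hc⟩ := ha
  obtain ⟨u, z, h⟩ := PPFormula.mem_sol_colonFormula.1 hb
  refine ⟨fun i => ∑ x, tmul R S (Sum.elim a c x) (u i x), fun j => ?_⟩
  calc _ = ∑ x, tmul R S (Sum.elim a c x)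
        (Sum.elim (fun x => ((1 : R) ⊗ₜ[ℤ] σ.A j (p x)) • b x) 0 x
          + ∑ i, ((1 : R) ⊗ₜ[ℤ] σ.B j i) • u i x) := by
        simp only [sum_smul_blockSum, tmul_add, Finset.sum_add_distrib, tmul_sum,
          Finset.smul_sum, smul_tmul]
        rw [Finset.sum_comm]
        congr 1
        simp
    _ = ∑ q, tmul R S (∑ x, Sum.elim (φ.A q) (φ.B q) x • Sum.elim a c x) (z j q) := by
        simp only [h, tmul_sum, sum_tmul, tmul_leftMul]
        rw [Finset.sum_comm]
    _ = 0 := by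
        refine Finset.sum_eq_zero fun q _ => ?_
        have e : ∑ x, Sum.elim (φ.A q) (φ.B q) x • Sum.elim a c x = 0 := by
          simpa using hc q
        rw [e, zero_tmul]

end Colon

/-! ### Solutions in the tensor product from generators and relations. -/

section Relations

variable {R S : Type u} [Ring R] [Ring S]
  {M : Type u} [AddCommGroup M] [Module Rᵐᵒᵖ M]
  {B : Type u} [AddCommGroup B] [Module (R ⊗[ℤ] Sᵐᵒᵖ) B]
  {ι κ : Type*}

variable (R S B ι) in
/-- The biadditive map sending `(f, b)` to the finitely supported family of the `f i • b`. -/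
noncomputable def scaleHom : (ι →₀ Rᵐᵒᵖ) →+ B →+ (ι →₀ B) :=
  (AddMonoidHom.mk' (fun b => Finsupp.mapRange.addMonoidHom ((leftMul R S B).flip b))
    fun b b' => by ext; simp).flip

@[simp]
theorem scaleHom_apply (f : ι →₀ Rᵐᵒᵖ) (b : B) (i : ι) :
    scaleHom R S B ι f b i = leftMul R S B (f i) b := by
  simp [scaleHom]

theorem scaleHom_smul (r : Rᵐᵒᵖ) (f : ι →₀ Rᵐᵒᵖ) (b : B) :
    scaleHom R S B ι (r • f) b = scaleHom R S B ι f (leftMul R S B r b) := by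
  ext i
  simp [leftMul_mul]

theorem scaleHom_single_one (i : ι) (b : B) :
    scaleHom R S B ι (Finsupp.single i 1) b = Finsupp.single i b := by
  classical
  ext j
  rcases eq_or_ne i j with rfl | h
  · simp [leftMul_apply, ← Algebra.TensorProduct.one_def]
  · simp [h]

variable (R S B) in
/-- The map from finitely supported families in `B` to the tensor product determined by a family of
elements of `M`. -/
noncomputable def tensorOfFinsupp (g : ι → M) : (ι →₀ B) →+ Tensor R S M B :=
  Finsupp.liftAddHom fun i => tmulHom R S M B (g i)

@[simp]
theorem tensorOfFinsupp_single (g : ι → M) (i : ι) (b : B) :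
    tensorOfFinsupp R S B g (Finsupp.single i b) = tmul R S (g i) b := by
  simp [tensorOfFinsupp, tmulHom_apply]

theorem tensorOfFinsupp_scaleHom (g : ι → M) (f : ι →₀ Rᵐᵒᵖ) (b : B) :
    tensorOfFinsupp R S B g (scaleHom R S B ι f b)
      = tmul R S (Finsupp.linearCombination Rᵐᵒᵖ g f) b := by
  induction f using Finsupp.induction_linear generalizing b with
  | zero => simp
  | add f f' hf hf' => simp [hf, hf', add_tmul]
  | single i r =>
    have h : Finsupp.single i r = r • Finsupp.single i (1 : Rᵐᵒᵖ) := by simp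
    rw [h, scaleHom_smul, scaleHom_single_one]
    simp [tmul_leftMul]

theorem tensorOfFinsupp_smul (g : ι → M) (s : Sᵐᵒᵖ) (x : ι →₀ B) :
    tensorOfFinsupp R S B g (((1 : R) ⊗ₜ[ℤ] s) • x) = s • tensorOfFinsupp R S B g x := by
  induction x using Finsupp.induction_linear with
  | zero => simp
  | add x y hx hy => simp [hx, hy]
  | single i b => simp [smul_tmul]

theorem tensorOfFinsupp_surjective {g : ι → M}
    (hg : Function.Surjective (Finsupp.linearCombination Rᵐᵒᵖ g)) :
    Function.Surjective (tensorOfFinsupp R S B g) := by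
  rw [← AddMonoidHom.range_eq_top, eq_top_iff]
  rintro x -
  induction x using Tensor.induction with
  | zero => exact zero_mem _
  | tmul m b =>
    obtain ⟨f, rfl⟩ := hg m
    exact ⟨_, tensorOfFinsupp_scaleHom g f b⟩
  | add x y hx hy => exact add_mem hx hy

/-- If `M` has generators `g` and relations `ρ`, then the relations `∑ g i ⊗ x i = 0` in the tensor
product are those coming from `ρ`. -/
theorem exists_of_tensorOfFinsupp_eq_zero {g : ι → M} {ρ : κ → ι →₀ Rᵐᵒᵖ}
    (hg : Function.Surjective (Finsupp.linearCombination Rᵐᵒᵖ g))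
    (hρ : LinearMap.ker (Finsupp.linearCombination Rᵐᵒᵖ g) ≤ Submodule.span Rᵐᵒᵖ (Set.range ρ))
    {x : ι →₀ B} (hx : tensorOfFinsupp R S B g x = 0) :
    ∃ z : κ →₀ B, x = z.sum fun q b => scaleHom R S B ι (ρ q) b := by
  -- `K` consists of the consequences of `ρ`. The map `Λ` built below, from the tensor product to
  -- the quotient by `K`, composes with `tensorOfFinsupp` to the quotient map, so anything killed by
  -- `tensorOfFinsupp` lies in `K`.
  let K : AddSubgroup (ι →₀ B) :=
    (Finsupp.liftAddHom fun q => scaleHom R S B ι (ρ q) : (κ →₀ B) →+ (ι →₀ B)).range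
  have hK : ∀ f ∈ Submodule.span Rᵐᵒᵖ (Set.range ρ), ∀ b, scaleHom R S B ι f b ∈ K := by
    intro f hf
    induction hf using Submodule.span_induction with
    | mem f hf =>
      obtain ⟨q, rfl⟩ := hf
      exact fun b => ⟨Finsupp.single q b, by simp⟩
    | zero => simp [zero_mem]
    | add f f' _ _ hf hf' => exact fun b => by simpa using add_mem (hf b) (hf' b)
    | smul r f _ hf => exact fun b => by simpa [scaleHom_smul] using hf _
  let π : (ι →₀ Rᵐᵒᵖ) →+ M := (Finsupp.linearCombination Rᵐᵒᵖ g).toAddMonoidHom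
  let h₀ : (ι →₀ Rᵐᵒᵖ) →+ B →+ (ι →₀ B) ⧸ K :=
    (AddMonoidHom.compHom (QuotientAddGroup.mk' K)).comp (scaleHom R S B ι)
  have h₀_ker : π.ker ≤ h₀.ker := by
    intro f hf
    ext b
    exact (QuotientAddGroup.eq_zero_iff _).2 (hK f (hρ hf) b)
  let h : M →+ B →+ (ι →₀ B) ⧸ K := π.liftOfSurjective hg ⟨h₀, h₀_ker⟩
  have h_apply : ∀ f, h (π f) = h₀ f := fun f =>
    π.liftOfRightInverse_comp_apply _ (Function.rightInverse_surjInv hg) ⟨h₀, h₀_ker⟩ f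
  let Λ : Tensor R S M B →+ (ι →₀ B) ⧸ K := Tensor.lift h fun m r b => by
    obtain ⟨f, rfl⟩ := hg m
    have e : MulOpposite.op r • Finsupp.linearCombination Rᵐᵒᵖ g f
      = π (MulOpposite.op r • f) := (map_smul _ _ _).symm
    rw [e, h_apply]
    refine Eq.trans ?_ (DFunLike.congr_fun (h_apply f) _).symm
    exact congrArg (QuotientAddGroup.mk' K) (scaleHom_smul _ _ _)
  have hΛ : Λ.comp (tensorOfFinsupp R S B g) = QuotientAddGroup.mk' K := by
    ext i b
    have e : g i = π (Finsupp.single i 1) := by simp [π]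
    simp only [AddMonoidHom.comp_apply, Finsupp.singleAddHom_apply, tensorOfFinsupp_single]
    refine (Tensor.lift_tmul h _ _ _).trans ?_
    rw [e, h_apply]
    exact congrArg (QuotientAddGroup.mk' K) (scaleHom_single_one i b)
  have hxK : x ∈ K := by
    rw [← QuotientAddGroup.eq_zero_iff]
    have := DFunLike.congr_fun hΛ x
    rw [AddMonoidHom.comp_apply, hx, map_zero] at this
    exact this.symm
  obtain ⟨z, hz⟩ := hxK
  exact ⟨z, hz.symm⟩

variable {n : ℕ} {Y : Type*}

/-- The pp formula saying that there are values for the variables in `Z` such that, together with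
the free variables, they satisfy the relations in `F`. -/
noncomputable def relationFormula (ρ : κ → Fin n ⊕ Y →₀ Rᵐᵒᵖ) (Z : Finset Y) (F : Finset κ) :
    PPFormula Rᵐᵒᵖ n where
  bound := Fin Z.card
  eqs := Fin F.card
  A q x := ρ (F.equivFin.symm q) (.inl x)
  B q y := ρ (F.equivFin.symm q) (.inr (Z.equivFin.symm y))

theorem mem_sol_relationFormula {ρ : κ → Fin n ⊕ Y →₀ Rᵐᵒᵖ} {Z : Finset Y} {F : Finset κ}
    {a : Fin n → M} {c : Y → M}
    (hρ : ∀ q ∈ F, Finsupp.linearCombination Rᵐᵒᵖ (Sum.elim a c) (ρ q) = 0)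
    (hZ : ∀ q ∈ F, (ρ q).support.toRight ⊆ Z) : a ∈ (relationFormula ρ Z F).sol M := by
  classical
  refine ⟨fun y : Fin Z.card => c (Z.equivFin.symm y), fun q : Fin F.card => ?_⟩
  have hq := (F.equivFin.symm q).2
  refine Eq.trans ?_ (hρ _ hq)
  have hsub : (ρ (F.equivFin.symm q)).support ⊆ Finset.univ.disjSum Z := by
    rintro (x | y) hxy
    · simp
    · simpa using hZ _ hq (Finset.mem_toRight.2 hxy)
  rw [Finsupp.linearCombination_apply, Finsupp.sum_of_support_subset _ hsub _ (by simp),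
    Finset.sum_disjSum]
  refine congrArg₂ (· + ·) rfl ?_
  rw [← Finset.sum_coe_sort Z, ← Z.equivFin.symm.sum_comp]
  rfl

theorem mem_sol_colonFormula_relationFormula {ρ : κ → Fin n ⊕ Y →₀ Rᵐᵒᵖ} {Z : Finset Y}
    {F : Finset κ} {k : ℕ} {p : Fin n → Fin k} {σ : PPFormula Sᵐᵒᵖ k} {b : Fin n → B}
    (u : σ.bound → Fin n ⊕ Y →₀ B) (z : σ.eqs → κ →₀ B) (hz : ∀ j, (z j).support ⊆ F)
    (h : ∀ j x, Sum.elim (fun x => ((1 : R) ⊗ₜ[ℤ] σ.A j (p x)) • b x) 0 x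
          + ∑ i, ((1 : R) ⊗ₜ[ℤ] σ.B j i) • u i x
          = (z j).sum fun q b => leftMul R S B (ρ q x) b) :
    b ∈ (colonFormula p σ (relationFormula ρ Z F)).sol B := by
  refine PPFormula.mem_sol_colonFormula.2
    ⟨fun i x => u i (Sum.map id (fun y : Fin Z.card => (Z.equivFin.symm y : Y)) x),
      fun j (q : Fin F.card) => z j (F.equivFin.symm q), fun j x => ?_⟩
  have hsum : ∀ x, (z j).sum (fun q b => leftMul R S B (ρ q x) b)
      = ∑ q : Fin F.card,
        leftMul R S B (ρ (F.equivFin.symm q) x) (z j (F.equivFin.symm q)) := by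
    intro x
    rw [Finsupp.sum_of_support_subset _ (hz j) _ (by simp), ← Finset.sum_coe_sort F,
      ← F.equivFin.symm.sum_comp]
  rcases x with x | y
  · exact (h j (.inl x)).trans (hsum _)
  · exact (h j (.inr (Z.equivFin.symm y : Y))).trans (hsum _)

/-- Witnesses for `σ` lift to families in `B` because the generators span; each equation then
becomes a family with zero image, hence a combination of relations. The result is `(σ : φ)` for a
possibly infinite presentation, with all data finitely supported. -/
theorem exists_of_blockSum_mem_sol {k : ℕ} {p : Fin n → Fin k} {σ : PPFormula Sᵐᵒᵖ k}
    {a : Fin n → M} {c : Y → M} {b : Fin n → B} {ρ : κ → Fin n ⊕ Y →₀ Rᵐᵒᵖ}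
    (hg : Function.Surjective (Finsupp.linearCombination Rᵐᵒᵖ (Sum.elim a c)))
    (hρ : LinearMap.ker (Finsupp.linearCombination Rᵐᵒᵖ (Sum.elim a c))
      ≤ Submodule.span Rᵐᵒᵖ (Set.range ρ))
    (h : blockSum p a b ∈ σ.sol (Tensor R S M B)) :
    ∃ (u : σ.bound → Fin n ⊕ Y →₀ B) (z : σ.eqs → κ →₀ B), ∀ j x,
      Sum.elim (fun x => ((1 : R) ⊗ₜ[ℤ] σ.A j (p x)) • b x) 0 x
          + ∑ i, ((1 : R) ⊗ₜ[ℤ] σ.B j i) • u i x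
          = (z j).sum fun q b => leftMul R S B (ρ q x) b := by
  classical
  obtain ⟨w, hw⟩ := h
  choose u hu using fun i => tensorOfFinsupp_surjective (R := R) (S := S) (B := B) hg (w i)
  have key : ∀ j, ∃ z : κ →₀ B,
      ∑ x, Finsupp.single (.inl x) (((1 : R) ⊗ₜ[ℤ] σ.A j (p x)) • b x)
        + ∑ i, ((1 : R) ⊗ₜ[ℤ] σ.B j i) • u i
        = z.sum fun q b => scaleHom R S B (Fin n ⊕ Y) (ρ q) b := by
    intro j
    refine exists_of_tensorOfFinsupp_eq_zero hg hρ ((Eq.trans ?_ (hw j)))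
    simp [sum_smul_blockSum, tensorOfFinsupp_smul, hu]
  choose z hz using key
  refine ⟨u, z, fun j x => ?_⟩
  have := DFunLike.congr_fun (hz j) x
  rw [Finsupp.sum, Finsupp.finsetSum_apply] at this
  simp only [scaleHom_apply] at this
  refine Eq.trans ?_ this
  rw [Finsupp.add_apply, Finsupp.finsetSum_apply, Finsupp.finsetSum_apply]
  congr 1
  rcases x with x | y
  · simp [Finsupp.single_apply]
  · simp

/-- If `a ⊗ b` satisfies `σ` blockwise, then `b` satisfies `(σ : φ)` for some `φ` satisfied
by `a`. -/
theorem exists_mem_sol_of_blockSum_mem_sol {k : ℕ} {p : Fin n → Fin k} {σ : PPFormula Sᵐᵒᵖ k}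
    {a : Fin n → M} {b : Fin n → B} (h : blockSum p a b ∈ σ.sol (Tensor R S M B)) :
    ∃ φ : PPFormula Rᵐᵒᵖ n, a ∈ φ.sol M ∧ b ∈ (colonFormula p σ φ).sol B := by
  classical
  -- The tautological presentation: besides `a`, every element of `M` is a generator, and every
  -- element of the kernel is a relation.
  let ρ : LinearMap.ker (Finsupp.linearCombination Rᵐᵒᵖ (Sum.elim a (id : M → M)))
    → Fin n ⊕ M →₀ Rᵐᵒᵖ := Subtype.val
  obtain ⟨u, z, huz⟩ := exists_of_blockSum_mem_sol (c := (id : M → M)) (ρ := ρ)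
    (fun m => ⟨Finsupp.single (.inr m) 1, by simp⟩)
    (fun q hq => Submodule.subset_span ⟨⟨q, hq⟩, rfl⟩) h
  -- Only relations used by some `z j` are kept, and only the generators occurring in them become
  -- bound variables.
  let F := Finset.univ.biUnion fun j => (z j).support
  exact ⟨relationFormula ρ (F.biUnion fun q => (ρ q).support.toRight) F,
    mem_sol_relationFormula (fun q _ => q.2)
      (fun q hq => Finset.subset_biUnion_of_mem (fun q => (ρ q).support.toRight) hq),
    mem_sol_colonFormula_relationFormula u z
      (fun j => Finset.subset_biUnion_of_mem (fun j => (z j).support) (Finset.mem_univ j)) huz⟩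

/-- Over a finitely presented module, the formula `φ` in `exists_mem_sol_of_blockSum_mem_sol` may be
chosen independently of the bimodule. -/
theorem exists_mem_sol_forall_of_finitePresentation [Module.FinitePresentation Rᵐᵒᵖ M]
    (a : Fin n → M) :
    ∃ φ : PPFormula Rᵐᵒᵖ n, a ∈ φ.sol M ∧
      ∀ (S : Type u) [Ring S] (B : Type u) [AddCommGroup B] [Module (R ⊗[ℤ] Sᵐᵒᵖ) B]
        (k : ℕ) (p : Fin n → Fin k) (σ : PPFormula Sᵐᵒᵖ k) (b : Fin n → B),
        blockSum p a b ∈ σ.sol (Tensor R S M B) → b ∈ (colonFormula p σ φ).sol B := by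
  classical
  obtain ⟨m, c, hc⟩ := Module.Finite.exists_fin (R := Rᵐᵒᵖ) (M := M)
  have hg : Function.Surjective (Finsupp.linearCombination Rᵐᵒᵖ (Sum.elim a c)) := by
    rw [← LinearMap.range_eq_top, Finsupp.range_linearCombination, eq_top_iff, ← hc]
    exact Submodule.span_mono (by simp)
  -- The entries of `a` are adjoined to a finite generating set; the relations remain finitely
  -- generated, and `F` is chosen before any bimodule appears.
  obtain ⟨F, hF⟩ := Module.FinitePresentation.fg_ker _ hg
  let ρ : F → Fin n ⊕ Fin m →₀ Rᵐᵒᵖ := Subtype.val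
  have hρ : ∀ q, Finsupp.linearCombination Rᵐᵒᵖ (Sum.elim a c) (ρ q) = 0 := fun q =>
    LinearMap.mem_ker.1 (hF.le (Submodule.subset_span q.2))
  refine ⟨relationFormula ρ Finset.univ Finset.univ,
    mem_sol_relationFormula (fun q _ => hρ q) (fun _ _ => Finset.subset_univ _), ?_⟩
  intro S _ B _ _ k p σ b h
  obtain ⟨u, z, huz⟩ := exists_of_blockSum_mem_sol (ρ := ρ) hg (by simp [ρ, hF]) h
  exact mem_sol_colonFormula_relationFormula u z (fun _ => Finset.subset_univ _) huz

end Relations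

/-! ### Tensoring, purity and the closure properties of `(E : D)`. -/

section Transporter

variable {R S : Type u} [Ring R] [Ring S]

theorem fpModules_le_atomicModules : fpModules R ≤ atomicModules R S := by
  intro M hM B n k p _ a σ
  have : Module.FinitePresentation Rᵐᵒᵖ M := hM
  obtain ⟨φ, ha, hφ⟩ := exists_mem_sol_forall_of_finitePresentation (R := R) a
  exact ⟨φ, ha, fun ψ hψ _ b hb => hφ S B k p σ b (blockSum_mem_sol hψ hb)⟩

theorem IsLimGeneratedBy.mono {T : Type u} [Ring T]
    {X Y Y' : CategoryTheory.ObjectProperty (ModuleCat.{u} T)} (h : IsLimGeneratedBy X Y)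
    (hY : Y ≤ Y') : IsLimGeneratedBy X Y' := by
  intro M hM
  obtain ⟨ι, i₁, i₂, i₃, i₄, G, f, hf, hG, e⟩ := h M hM
  exact ⟨ι, i₁, i₂, i₃, i₄, G, f, hf, fun i => ⟨(hG i).1, hY _ (hG i).2⟩, e⟩

/-- For a module that is atomic with respect to a bimodule, the subgroups `(σ : ψ)(B)`, with `ψ` in
the pp-type of a tuple, have a greatest element. -/
theorem IsAtomicWrt.exists_forall_le {M : RightMod R} {B : Bimod R S} (h : IsAtomicWrt M B)
    {n k : ℕ} {p : Fin n → Fin k} (hp : Function.Surjective p) (a : Fin n → M)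
    (σ : PPFormula Sᵐᵒᵖ k) :
    ∃ φ : PPFormula Rᵐᵒᵖ n, a ∈ φ.sol M ∧ ∀ ψ : PPFormula Rᵐᵒᵖ n, a ∈ ψ.sol M →
      (colonFormula p σ ψ).sol B ⊆ (colonFormula p σ φ).sol B := by
  obtain ⟨φ, hφ, hmax⟩ := h n k p hp a σ
  refine ⟨φ, hφ, fun ψ hψ => ?_⟩
  have hsub := PPFormula.sol_colonFormula_conj (B := B) (p := p) (σ := σ) φ ψ
  exact (Set.subset_union_right.trans hsub).trans
    (hmax (PPFormula.mem_sol_conj hφ hψ) (Set.subset_union_left.trans hsub))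

theorem map_blockSum {M M' : Type u} [AddCommGroup M] [Module Rᵐᵒᵖ M] [AddCommGroup M']
    [Module Rᵐᵒᵖ M'] {B B' : Type u} [AddCommGroup B] [Module (R ⊗[ℤ] Sᵐᵒᵖ) B]
    [AddCommGroup B'] [Module (R ⊗[ℤ] Sᵐᵒᵖ) B'] (f : M →ₗ[Rᵐᵒᵖ] M')
    (g : B →ₗ[R ⊗[ℤ] Sᵐᵒᵖ] B') {n k : ℕ} (p : Fin n → Fin k) (a : Fin n → M) (b : Fin n → B) :
    (fun l => Tensor.map f g (blockSum p a b l))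
      = blockSum p (fun x => f (a x)) (fun x => g (b x)) := by
  ext l
  simp only [blockSum, map_sum, apply_ite (Tensor.map f g), Tensor.map_tmul, map_zero]

/-- Tensoring with a fixed module preserves pure maps. -/
theorem IsPureMap.tensorMap {B B' : Type u} [AddCommGroup B] [Module (R ⊗[ℤ] Sᵐᵒᵖ) B]
    [AddCommGroup B'] [Module (R ⊗[ℤ] Sᵐᵒᵖ) B'] {g : B →ₗ[R ⊗[ℤ] Sᵐᵒᵖ] B'} (hg : IsPureMap g)
    (M : Type u) [AddCommGroup M] [Module Rᵐᵒᵖ M] :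
    IsPureMap (Tensor.map (LinearMap.id : M →ₗ[Rᵐᵒᵖ] M) g) := by
  intro k σ v hv
  obtain ⟨n, p, -, a, b, rfl⟩ := exists_eq_blockSum v
  rw [map_blockSum] at hv
  obtain ⟨φ, hφ, hb⟩ := exists_mem_sol_of_blockSum_mem_sol hv
  exact blockSum_mem_sol hφ (hg n _ b hb)

/-- The comparison map from the tensor product with a product to the product of the tensor
products. -/
def tensorPi (M : Type u) [AddCommGroup M] [Module Rᵐᵒᵖ M] {ι : Type u} (B : ι → Type u)
    [∀ i, AddCommGroup (B i)] [∀ i, Module (R ⊗[ℤ] Sᵐᵒᵖ) (B i)] :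
    Tensor R S M (∀ i, B i) →ₗ[Sᵐᵒᵖ] ∀ i, Tensor R S M (B i) :=
  LinearMap.pi fun i => Tensor.map LinearMap.id (LinearMap.proj i)

/-- The greatest subgroup `(σ : φ)` on the product bimodule provides one `φ` for all coordinates at
once. -/
theorem IsAtomicWrt.isPureMap_tensorPi {M : RightMod R} {ι : Type u} {B : ι → Bimod R S}
    (h : IsAtomicWrt M (ModuleCat.of (R ⊗[ℤ] Sᵐᵒᵖ) (∀ i, B i))) :
    IsPureMap (tensorPi (R := R) (S := S) M fun i => B i) := by
  classical
  intro k σ v hv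
  obtain ⟨n, p, hp, a, b, rfl⟩ := exists_eq_blockSum v
  obtain ⟨φ, hφ, hmax⟩ := h.exists_forall_le hp a σ
  refine blockSum_mem_sol hφ (PPFormula.mem_sol_pi.2 fun i => ?_)
  have hvi : blockSum p a (fun x => b x i) ∈ σ.sol (Tensor R S M (B i)) := by
    have := PPFormula.mem_sol_pi.1 hv i
    simp only [tensorPi, LinearMap.pi_apply] at this
    rwa [map_blockSum] at this
  obtain ⟨ψ, hψ, hbi⟩ := exists_mem_sol_of_blockSum_mem_sol hvi
  -- The `i`-th coordinate of `b`, extended by zero, satisfies `(σ : ψ)` in the product, hence `(σ :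
  -- φ)`; projecting back removes the dependence on `i`.
  have hmem := hmax ψ hψ
    (PPFormula.sol_map (LinearMap.single (R ⊗[ℤ] Sᵐᵒᵖ) (fun i => (B i : Type u)) i) hbi)
  simpa using PPFormula.mem_sol_pi.1 hmem i

theorem Tensor.directedSystem {ι : Type u} [Preorder ι] {G : ι → Type u}
    [∀ i, AddCommGroup (G i)] [∀ i, Module Rᵐᵒᵖ (G i)] {f : ∀ i j, i ≤ j → G i →ₗ[Rᵐᵒᵖ] G j}
    [DirectedSystem G fun i j h => f i j h] {H : ι → Type u} [∀ i, AddCommGroup (H i)]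
    [∀ i, Module (R ⊗[ℤ] Sᵐᵒᵖ) (H i)] {g : ∀ i j, i ≤ j → H i →ₗ[R ⊗[ℤ] Sᵐᵒᵖ] H j}
    [DirectedSystem H fun i j h => g i j h] :
    DirectedSystem (fun i => Tensor R S (G i) (H i))
      fun i j h => Tensor.map (f i j h) (g i j h) where
  map_self i x := by
    refine DFunLike.congr_fun (g := (LinearMap.id : _ →ₗ[Sᵐᵒᵖ] _))
      (Tensor.linearMap_ext fun m b => ?_) x
    simp [DirectedSystem.map_self' f, DirectedSystem.map_self' g]
  map_map k j i hij hjk x := by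
    refine DFunLike.congr_fun (f := Tensor.map (f j k hjk) (g j k hjk) ∘ₗ
      Tensor.map (f i j hij) (g i j hij)) (Tensor.linearMap_ext fun m b => ?_) x
    simp [DirectedSystem.map_map' f, DirectedSystem.map_map' g]

/-- The tensor product commutes with directed colimits in both variables. -/
theorem IsDirectedColimitCocone.tensorMap {ι : Type u} [Preorder ι] [IsDirectedOrder ι]
    [Nonempty ι] {G : ι → Type u} [∀ i, AddCommGroup (G i)] [∀ i, Module Rᵐᵒᵖ (G i)]
    {f : ∀ i j, i ≤ j → G i →ₗ[Rᵐᵒᵖ] G j} [DirectedSystem G fun i j h => f i j h]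
    {H : ι → Type u} [∀ i, AddCommGroup (H i)] [∀ i, Module (R ⊗[ℤ] Sᵐᵒᵖ) (H i)]
    {g : ∀ i j, i ≤ j → H i →ₗ[R ⊗[ℤ] Sᵐᵒᵖ] H j} [DirectedSystem H fun i j h => g i j h]
    {M : Type u} [AddCommGroup M] [Module Rᵐᵒᵖ M] {B : Type u} [AddCommGroup B]
    [Module (R ⊗[ℤ] Sᵐᵒᵖ) B] {c : ∀ i, G i →ₗ[Rᵐᵒᵖ] M} {d : ∀ i, H i →ₗ[R ⊗[ℤ] Sᵐᵒᵖ] B}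
    (hc : IsDirectedColimitCocone f c) (hd : IsDirectedColimitCocone g d) :
    IsDirectedColimitCocone (fun i j h => Tensor.map (f i j h) (g i j h))
      fun i => Tensor.map (c i) (d i) where
  compat i j h x := by
    refine DFunLike.congr_fun (f := Tensor.map (c j) (d j) ∘ₗ Tensor.map (f i j h) (g i j h))
      (Tensor.linearMap_ext fun m b => ?_) x
    simp [hc.compat, hd.compat]
  exists_of x := by
    obtain ⟨n, p, -, a, b, hab⟩ := exists_eq_blockSum (fun _ : Fin 1 => x)
    obtain ⟨i, -, a', ha⟩ := hc.exists_stage_of_finite a (Classical.arbitrary ι)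
    obtain ⟨j, hij, b', hb⟩ := hd.exists_stage_of_finite b i
    refine ⟨j, blockSum p (fun x => f i j hij (a' x)) b' 0, ?_⟩
    have h := congrFun (map_blockSum (c j) (d j) p (fun x => f i j hij (a' x)) b') 0
    simp only [hc.compat, ha, hb] at h
    rw [h, ← hab]
  zero_exact i x hx := by
    obtain ⟨n, p, -, a, b, hab⟩ := exists_eq_blockSum (fun _ : Fin 1 => x)
    -- Vanishing is the pp condition `σ := (v = 0)`. The criterion splits it into pp conditions on
    -- the two factors, each of which already holds at some stage.
    have h : blockSum p (fun x => c i (a x)) (fun x => d i (b x))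
        ∈ (PPFormula.isZero Sᵐᵒᵖ).sol (Tensor R S M B) := by
      rw [PPFormula.mem_sol_isZero, ← map_blockSum, ← hab]
      exact hx
    obtain ⟨φ, ha, hb⟩ := exists_mem_sol_of_blockSum_mem_sol h
    obtain ⟨j, hij, ha⟩ := hc.exists_stage_mem_sol ha
    obtain ⟨k, hik, hb⟩ := hd.exists_stage_mem_sol hb
    obtain ⟨l, hjl, hkl⟩ := exists_ge_ge j k
    refine ⟨l, hij.trans hjl, ?_⟩
    have ha := PPFormula.sol_map (f j l hjl) ha
    have hb := PPFormula.sol_map (g k l hkl) hb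
    simp only [DirectedSystem.map_map' f] at ha
    simp only [DirectedSystem.map_map' g] at hb
    have h' := blockSum_mem_sol ha hb
    rwa [PPFormula.mem_sol_isZero, ← map_blockSum, ← hab] at h'

theorem IsDirectedColimitCocone.isDirectedColimitOf {T : Type u} [Ring T]
    {X : CategoryTheory.ObjectProperty (ModuleCat.{u} T)} {ι : Type u} [Preorder ι]
    [IsDirectedOrder ι] [Nonempty ι] {G : ι → ModuleCat.{u} T} {f : ∀ i j, i ≤ j → G i →ₗ[T] G j}
    (hf : DirectedSystem (fun i => G i) fun i j h => f i j h) {M : ModuleCat.{u} T}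
    {c : ∀ i, G i →ₗ[T] M} (hc : IsDirectedColimitCocone f c) (hG : ∀ i, X (G i)) :
    IsDirectedColimitOf X M := by
  classical
  exact ⟨ι, inferInstance, inferInstance, inferInstance, inferInstance, G, f, hf, hG,
    ⟨LinearEquiv.ofBijective _ hc.bijective_lift⟩⟩

theorem IsDirectedColimitOf.tensor_left {X : CategoryTheory.ObjectProperty (RightMod R)}
    {Y : CategoryTheory.ObjectProperty (RightMod S)} {M : RightMod R}
    (hM : IsDirectedColimitOf X M) (B : Bimod R S) (h : ∀ N, X N → Y (tensorObj N B)) :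
    IsDirectedColimitOf Y (tensorObj M B) := by
  obtain ⟨ι, _, _, _, _, G, f, hf, hG, ⟨e⟩⟩ := hM
  have : DirectedSystem (fun _ : ι => (B : Type u)) fun i j (_ : i ≤ j) =>
    (LinearMap.id : B →ₗ[R ⊗[ℤ] Sᵐᵒᵖ] B) := ⟨fun _ _ => rfl, fun _ _ _ _ _ _ => rfl⟩
  exact ((isDirectedColimitCocone_of_linearEquiv e).tensorMap
    (isDirectedColimitCocone_const (T := R ⊗[ℤ] Sᵐᵒᵖ) (M := B))).isDirectedColimitOf
      (G := fun i => tensorObj (G i) B) Tensor.directedSystem fun i => h _ (hG i)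

theorem IsDirectedColimitOf.tensor_right {X : CategoryTheory.ObjectProperty (Bimod R S)}
    {Y : CategoryTheory.ObjectProperty (RightMod S)} {B : Bimod R S}
    (hB : IsDirectedColimitOf X B) (M : RightMod R) (h : ∀ C, X C → Y (tensorObj M C)) :
    IsDirectedColimitOf Y (tensorObj M B) := by
  obtain ⟨ι, _, _, _, _, G, f, hf, hG, ⟨e⟩⟩ := hB
  have : DirectedSystem (fun _ : ι => (M : Type u)) fun i j (_ : i ≤ j) =>
    (LinearMap.id : M →ₗ[Rᵐᵒᵖ] M) := ⟨fun _ _ => rfl, fun _ _ _ _ _ _ => rfl⟩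
  exact ((isDirectedColimitCocone_const (T := Rᵐᵒᵖ) (M := M)).tensorMap
    (isDirectedColimitCocone_of_linearEquiv e)).isDirectedColimitOf
      (G := fun i => tensorObj M (G i)) Tensor.directedSystem fun i => h _ (hG i)

theorem isPureMap_linearEquiv {T : Type u} [Ring T] {M N : Type u} [AddCommGroup M] [Module T M]
    [AddCommGroup N] [Module T N] (e : M ≃ₗ[T] N) : IsPureMap e.toLinearMap := by
  intro n φ a h
  simpa using PPFormula.sol_map e.symm.toLinearMap h

theorem isDefinable_transporter {D : CategoryTheory.ObjectProperty (RightMod R)}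
    {E : CategoryTheory.ObjectProperty (RightMod S)}
    (hD : IsLimGeneratedBy D (atomicModules R S)) (hE : IsDefinable E) :
    IsDefinable (transporter E D) where
  iso B C := fun ⟨e⟩ hB M hM =>
    hE.of_isPureMap (M := tensorObj M C) (N := tensorObj M B) _
      ((isPureMap_linearEquiv e.symm).tensorMap M) (hB M hM)
  pi ι B hB M hM := by
    -- Purity of the comparison map is available only for atomic modules, so `M` is first replaced
    -- by the members `N` of a directed system with colimit `M`.
    refine hE.directedColimit _ ((hD M hM).tensor_left _ fun N hN => ?_)
    exact hE.of_isPureMap (M := tensorObj N (ModuleCat.of (R ⊗[ℤ] Sᵐᵒᵖ) (∀ i, B i)))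
      (N := ModuleCat.of Sᵐᵒᵖ (∀ i, tensorObj N (B i))) _ 
      (IsAtomicWrt.isPureMap_tensorPi (hN.2 _))
      (hE.pi ι (fun i => tensorObj N (B i)) fun i => hB i N hN.1)
  directedColimit B hB M hM :=
    hE.directedColimit _ (hB.tensor_right M fun C hC => hC M hM)
  pure B P hP hB M hM :=
    have hP' : IsPureMap P.subtype := hP
    hE.of_isPureMap (M := tensorObj M (ModuleCat.of (R ⊗[ℤ] Sᵐᵒᵖ) P)) (N := tensorObj M B) _
      (hP'.tensorMap M) (hB M hM)

end Transporter

end DefSub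

theorem theorem4p25 {R S : Type u} [Ring R] [Ring S]
    (D : CategoryTheory.ObjectProperty (DefSub.RightMod R)) (hD : DefSub.IsDefinable D) :
    ((DefSub.IsLimGeneratedBy D (DefSub.atomicModules R S)) →
      ∀ E : CategoryTheory.ObjectProperty (DefSub.RightMod S), DefSub.IsDefinable E →
        DefSub.IsDefinable (DefSub.transporter E D)) ∧
    (DefSub.IsLimGeneratedBy D (DefSub.fpModules R) →
      DefSub.IsLimGeneratedBy D (DefSub.atomicModules R S)) :=
  ⟨fun h _ hE => DefSub.isDefinable_transporter h hE,
    fun h => h.mono DefSub.fpModules_le_atomicModules⟩
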